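/- Let $p$ be an odd prime and let $m$ be a positive integer. For a positive integer $k$ such that $m/\gcd(m,k)$ is odd, a field automorphism $\sigma$ of $\mathbb{F}_{p^m}$ and a non-square $\alpha\in\mathbb{F}_{p^m}$, let $\mathbb{P}_{k,\sigma}$ denote the presemifield on $\mathbb{F}_{p^m}\times\mathbb{F}_{p^m}$ (identified, as an additive group, with $\mathbb{F}_{p^{2m}}$) with the usual addition and the multiplication $$(a,b)*(c,d)=\bigl(a\circ_k c+\alpha\,\sigma(b\circ_k d),\ ad+bc\bigr),\qquad x\circ_k y=x^{p^k}y+y^{p^k}x .$$ Two presemifields with multiplications $*$ and $\star$ are called isotopic if there are bijective $\mathbb{F}_p$-linear maps $M,N,L$ from the first to the second such that $M(x)\star N(y)=L(x*y)$ for all $x,y$. Let $k,s,r,t$ be integers with $0<k,s\le\lfloor m/2\rfloor$ and $0\le r,t\le\lfloor m/2\rfloor$ such that $m/\gcd(m,k)$ and $m/\gcd(m,s)$ are odd, let $\sigma(x)=x^{p^r}$ and $\tau(x)=x^{p^t}$ on $\mathbb{F}_{p^m}$, and assume that $\sigma$ is not the identity. If $(k,\sigma)\neq(s,\tau)$, then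 $\mathbb{P}_{k,\sigma}$ and $\mathbb{P}_{s,\tau}$ are not isotopic, whichever non-squares $\alpha$ and $\beta$ of $\mathbb{F}_{p^m}$ are used to define $\mathbb{P}_{k,\sigma}$ and $\mathbb{P}_{s,\tau}$ respectively. -/

import Mathlib

/-- Two multiplications on elementary abelian `p`-groups (`𝔽_p`-vector spaces) `V` and `W` are
isotopic if there are bijective `𝔽_p`-linear maps `M`, `N`, `L` with `M x ⋆ N y = L (x * y)`. -/
def IsIsotopic (p : ℕ) {V W : Type*} [AddCommGroup V] [Module (ZMod p) V]
    [AddCommGroup W] [Module (ZMod p) W] (mul₁ : V → V → V) (mul₂ : W → W → W) : Prop :=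
  ∃ M N L : V ≃ₗ[ZMod p] W, ∀ x y : V, mul₂ (M x) (N y) = L (mul₁ x y)

/-- The multiplication `x ∘ₖ y = x ^ (p ^ k) * y + y ^ (p ^ k) * x`. -/
def albertMul {F : Type*} [Field F] (p k : ℕ) (x y : F) : F :=
  x ^ (p ^ k) * y + y ^ (p ^ k) * x

/-- The multiplication
`(a, b) * (c, d) = (a ∘ₖ c + α (b ∘ₖ d) ^ σ, a d + b c)` of the presemifield `P_{k,σ}` on
`F × F`, where `F` is the field with `p ^ m` elements. -/
def presemifieldMul {F : Type*} [Field F] (p k : ℕ) (σ : F ≃+* F) (α : F) (x y : F × F) : F × F :=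
  (albertMul p k x.1 y.1 + α * σ (albertMul p k x.2 y.2), x.1 * y.2 + x.2 * y.1)

/-!
Write `F` for the field with `p ^ m` elements and `G` for its Galois group over `𝔽_p`. By Dedekind's
lemma the elements of `G` form an `F`-basis of the additive maps `F → F` (`exists_eq_sum_aut`), so
every bilinear map `(F × F) × (F × F) → F` has a unique coefficient matrix, indexed by two copies of
`G`.

Let `M, N, L` be an isotopism. The second component of its defining equation reads
`M₁ ⊗ N₂ + M₂ ⊗ N₁ = L₂ ∘ *`, so the coefficient matrix of the right-hand side has rank at most two.
That matrix (`productMatrix`) has two diagonal blocks, which are weighted adjacency matrices of the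
graph with edges `{h, h * κ}`, and two equal diagonal matrices off the diagonal. Writing `l` for the
weights coming from the restriction of `L₂` to `F × 0`, a nonzero weight gives an invertible
`2 × 2` minor. Rank two then expresses the second block, whose weights are shifted by `σ`, through
this minor and the diagonal matrices, which is impossible unless `σ = 1` or `κ ^ 2 = 1`
(`coeff_eq_zero_of_rank_two`). Hence `L₂` vanishes on `F × 0`, and rank two forces it to be a
multiple of a single automorphism `g` on `0 × F`. It follows that all components of `M` and `N` are
`F`-combinations of `g a` and `g b` (`support_of_rank_two`).

In the first component of the equation, the left-hand side therefore involves on each diagonal block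
only the pairs `(ς * g, g)` and `(τ * ς * g, τ * g)` and their transposes. On the right, an
automorphism `f` occurring in the restriction of `L₁` to `F × 0` contributes the pair `(f * κ, f)`
to the first block and the pair `(f * σ * κ, f * σ)` to the second. Comparing these gives
`κ = ς` or `κ = ς⁻¹`, and `σ = τ` or `σ = τ⁻¹` (`eq_or_eq_inv_of_isotopism`). For powers of
Frobenius with exponents in `[0, m / 2]`, being equal up to inversion means being equal. The
condition that `m / gcd m k` is odd excludes `κ ^ 2 = 1`, that is, `m = 2 * k`.
-/

/-! ### Coefficients with respect to the automorphisms -/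

section Coefficients

open Finset

variable {K F : Type*} [Field K] [Field F] [Algebra K F]

/-- The `K`-linear maps `F × F → F` given by applying an automorphism to one of the two coordinates:
`Sum.inl g` acts on the first coordinate, `Sum.inr g` on the second. -/
def evalAut (i : Gal(F/K) ⊕ Gal(F/K)) (x : F × F) : F :=
  Sum.elim (fun g => g x.1) (fun g => g x.2) i

theorem linearIndependent_aut :
    LinearIndependent F (fun g : Gal(F/K) => g.toLinearMap) :=
  (linearIndependent_toLinearMap K F F).comp (fun g : Gal(F/K) => (g : F →ₐ[K] F))
    AlgEquiv.coe_toAlgHom_injective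

variable [FiniteDimensional K F]

theorem sum_evalAut (c : Gal(F/K) ⊕ Gal(F/K) → F) (x : F × F) :
    ∑ i, c i * evalAut i x =
      ∑ g, c (Sum.inl g) * g x.1 + ∑ g, c (Sum.inr g) * g x.2 := by
  simp [Fintype.sum_sum_type, evalAut]

theorem eq_zero_of_sum_aut_eq_zero {c : Gal(F/K) → F} (h : ∀ x, ∑ g, c g * g x = 0) :
    c = 0 := by
  have hc : ∑ g, c g • (g.toLinearMap : F →ₗ[K] F) = 0 := by
    ext x
    simpa using h x
  have hli := linearIndependent_aut (K := K) (F := F)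
  rw [Fintype.linearIndependent_iff] at hli
  exact funext (hli c hc)

/-- The automorphisms form an `F`-basis of `F →ₗ[K] F`: they are independent by Dedekind's lemma
and there are `[F : K]` of them. For finite fields this is the representation of additive maps by
linearized polynomials. -/
theorem exists_eq_sum_aut [IsGalois K F] (f : F →ₗ[K] F) :
    ∃ c : Gal(F/K) → F, ∀ x, f x = ∑ g, c g * g x := by
  have hcard : Fintype.card Gal(F/K) = Module.finrank F (F →ₗ[K] F) := by
    rw [Module.finrank_linearMap_self, Fintype.card_eq_nat_card, IsGalois.card_aut_eq_finrank]
  have hspan := (linearIndependent_aut (K := K) (F := F)).span_eq_top_of_card_eq_finrank' hcard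
  have hf : f ∈ Submodule.span F (Set.range fun g : Gal(F/K) => g.toLinearMap) := by
    rw [hspan]; trivial
  obtain ⟨c, hc⟩ := (Submodule.mem_span_range_iff_exists_fun F).1 hf
  exact ⟨c, fun x => by rw [← hc]; simp⟩

theorem exists_eq_sum_evalAut [IsGalois K F] (f : F × F →ₗ[K] F) :
    ∃ c : Gal(F/K) ⊕ Gal(F/K) → F, ∀ x, f x = ∑ i, c i * evalAut i x := by
  obtain ⟨c, hc⟩ := exists_eq_sum_aut (f ∘ₗ LinearMap.inl K F F)
  obtain ⟨d, hd⟩ := exists_eq_sum_aut (f ∘ₗ LinearMap.inr K F F)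
  refine ⟨Sum.elim c d, fun x => ?_⟩
  rw [sum_evalAut]
  simp only [Sum.elim_inl, Sum.elim_inr, ← hc, ← hd, LinearMap.comp_apply, ← map_add]
  simp

theorem eq_zero_of_sum_evalAut_eq_zero {c : Gal(F/K) ⊕ Gal(F/K) → F}
    (h : ∀ x, ∑ i, c i * evalAut i x = 0) : c = 0 := by
  simp only [sum_evalAut] at h
  have h₁ := eq_zero_of_sum_aut_eq_zero (c := fun g => c (Sum.inl g))
    fun x => by simpa using h (x, 0)
  have h₂ := eq_zero_of_sum_aut_eq_zero (c := fun g => c (Sum.inr g))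
    fun x => by simpa using h (0, x)
  funext i
  cases i with
  | inl g => exact congrFun h₁ g
  | inr g => exact congrFun h₂ g

/-- Coefficients of bilinear expressions in a linearly independent finite family of functions are
unique. -/
theorem matrix_ext_of_sum {ι X F : Type*} [Fintype ι] [Field F] {e : ι → X → F}
    (he : ∀ c : ι → F, (∀ x, ∑ i, c i * e i x = 0) → c = 0) {C D : ι → ι → F}
    (h : ∀ x y, ∑ i, ∑ j, C i j * e i x * e j y = ∑ i, ∑ j, D i j * e i x * e j y) : C = D := by
  rw [← sub_eq_zero]
  funext i j
  have hy (y : X) := congrFun (he (fun i => ∑ j, (C i j - D i j) * e j y) fun x => by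
      simp only [sum_mul, sub_mul, sum_sub_distrib, sub_eq_zero]
      simpa only [mul_right_comm] using h x y) i
  exact congrFun (he _ hy) j

end Coefficients

/-! ### The coefficient matrix of the multiplication -/

section ProductMatrix

open Finset
open scoped Classical

variable {K F : Type*} [Field K] [Field F] [Algebra K F]

/-- The presemifield multiplication of `P_{k,σ}` for arbitrary automorphisms: `κ` takes the place of
`x ↦ x ^ (p ^ k)`. -/
def autMul (κ σ : Gal(F/K)) (α : F) (x y : F × F) : F × F :=
  ((κ x.1 * y.1 + κ y.1 * x.1) + α * σ (κ x.2 * y.2 + κ y.2 * x.2), x.1 * y.2 + x.2 * y.1)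

/-- The coefficients of the bilinear form `(a, c) ↦ ∑ h, l h * h (κ a * c + κ c * a)` with respect
to the products `g a * h c`: a weighted adjacency matrix of the graph with edges `{h, h * κ}`. -/
noncomputable def albertMatrix (κ : Gal(F/K)) (l : Gal(F/K) → F) (g h : Gal(F/K)) : F :=
  (if g = h * κ then l h else 0) + (if h = g * κ then l g else 0)

/-- The coefficients of `x ↦ ∑ h, l h * h (α * σ x)`. -/
def twistCoeff (σ : Gal(F/K)) (α : F) (l : Gal(F/K) → F) (h : Gal(F/K)) : F :=
  l (h * σ⁻¹) * (h * σ⁻¹) α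

/-- The coefficient matrix of `(x, y) ↦ L (autMul κ σ α x y)`, where `L : F × F → F` has
coefficients `l` on the first coordinate and `d` on the second. -/
noncomputable def productMatrix (κ σ : Gal(F/K)) (α : F) (l d : Gal(F/K) → F) :
    Gal(F/K) ⊕ Gal(F/K) → Gal(F/K) ⊕ Gal(F/K) → F
  | Sum.inl g, Sum.inl h => albertMatrix κ l g h
  | Sum.inl g, Sum.inr h => if g = h then d g else 0
  | Sum.inr g, Sum.inl h => if g = h then d g else 0
  | Sum.inr g, Sum.inr h => albertMatrix κ (twistCoeff σ α l) g h

variable [FiniteDimensional K F]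

theorem sum_albertMatrix (κ : Gal(F/K)) (l : Gal(F/K) → F) (a c : F) :
    ∑ g, ∑ h, albertMatrix κ l g h * g a * h c = ∑ h, l h * h (κ a * c + κ c * a) := by
  have h₁ : ∑ g, ∑ h, (if g = h * κ then l h else 0) * g a * h c =
      ∑ h, l h * h (κ a) * h c := by
    rw [sum_comm]
    simp only [ite_mul, zero_mul, sum_ite_eq', mem_univ, if_true, AlgEquiv.mul_apply]
  have h₂ : ∑ g, ∑ h, (if h = g * κ then l g else 0) * g a * h c =
      ∑ g, l g * g a * g (κ c) := by
    simp only [ite_mul, zero_mul, sum_ite_eq', mem_univ, if_true, AlgEquiv.mul_apply]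
  simp only [albertMatrix, add_mul, sum_add_distrib, h₁, h₂]
  rw [← sum_add_distrib]
  refine sum_congr rfl fun h _ => ?_
  simp only [map_add, map_mul]
  ring

theorem sum_twistCoeff (σ : Gal(F/K)) (α : F) (l : Gal(F/K) → F) (x : F) :
    ∑ h, twistCoeff σ α l h * h x = ∑ h, l h * h (α * σ x) := by
  refine (Fintype.sum_equiv (Equiv.mulRight σ) _ _ fun h => ?_).symm
  simp [twistCoeff, mul_assoc]

theorem sum_productMatrix (κ σ : Gal(F/K)) (α : F) (c : Gal(F/K) ⊕ Gal(F/K) → F) (x y : F × F) :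
    ∑ i, ∑ j, productMatrix κ σ α (fun g => c (Sum.inl g)) (fun g => c (Sum.inr g)) i j *
      evalAut i x * evalAut j y = ∑ i, c i * evalAut i (autMul κ σ α x y) := by
  have hd (a b : F) : ∑ g : Gal(F/K), ∑ h : Gal(F/K),
      (if g = h then c (Sum.inr g) else 0) * g a * h b = ∑ g, c (Sum.inr g) * g (a * b) := by
    simp only [ite_mul, zero_mul, sum_ite_eq, mem_univ, if_true, map_mul, mul_assoc]
  rw [sum_evalAut]
  simp only [Fintype.sum_sum_type, sum_add_distrib, evalAut, Sum.elim_inl, Sum.elim_inr,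
    productMatrix, hd, sum_albertMatrix, sum_twistCoeff, autMul]
  simp only [map_add (_ : Gal(F/K)) (_ * _ + _ * _) (_ * _), map_add (_ : Gal(F/K)) (x.1 * y.2),
    mul_add, sum_add_distrib, mul_comm x.2 y.1]
  simp only [map_add, mul_add, sum_add_distrib]
  abel

end ProductMatrix

/-! ### Matrices of rank two -/

section RankTwo

variable {ι F : Type*} [Field F]

theorem minor_eq_zero_of_rank_two {B : ι → ι → F} {p q r s : ι → F}
    (hB : ∀ i j, B i j = p i * q j + r i * s j) (i₁ i₂ i₃ j₁ j₂ j₃ : ι) :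
    B i₁ j₁ * (B i₂ j₂ * B i₃ j₃ - B i₂ j₃ * B i₃ j₂) -
      B i₁ j₂ * (B i₂ j₁ * B i₃ j₃ - B i₂ j₃ * B i₃ j₁) +
      B i₁ j₃ * (B i₂ j₁ * B i₃ j₂ - B i₂ j₂ * B i₃ j₁) = 0 := by
  simp only [hB]
  ring

/-- A matrix of rank two is determined by two of its rows and columns, here those of an invertible
`2 × 2` block with zero diagonal and equal off-diagonal entries. -/
theorem mul_eq_of_rank_two {B : ι → ι → F} {p q r s : ι → F}
    (hB : ∀ i j, B i j = p i * q j + r i * s j) {u v : ι} {c : F} (hc : c ≠ 0)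
    (huu : B u u = 0) (hvv : B v v = 0) (huv : B u v = c) (hvu : B v u = c) (i j : ι) :
    c * B i j = B i u * B v j + B i v * B u j := by
  have h := minor_eq_zero_of_rank_two hB u v i u v j
  rw [huu, hvv, huv, hvu] at h
  exact mul_left_cancel₀ hc (by linear_combination -h)

/-- If `B = p ⊗ q + r ⊗ s` with `q`, `s` not proportional, then `p` and `r` lie in the column space
of `B`; so they vanish wherever `B` has a zero row. -/
theorem eq_zero_of_row_eq_zero {B : ι → ι → F} {p q r s : ι → F}
    (hB : ∀ i j, B i j = p i * q j + r i * s j) {j₁ j₂ : ι}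
    (hj : q j₁ * s j₂ - q j₂ * s j₁ ≠ 0) {i : ι} (hi : ∀ j, B i j = 0) : p i = 0 ∧ r i = 0 := by
  have h₁ := (hB i j₁).symm.trans (hi j₁)
  have h₂ := (hB i j₂).symm.trans (hi j₂)
  constructor
  · exact (mul_eq_zero.1 (by linear_combination s j₂ * h₁ - s j₁ * h₂)).resolve_right hj
  · exact (mul_eq_zero.1 (by linear_combination q j₁ * h₂ - q j₂ * h₁)).resolve_right hj

end RankTwo

/-! ### Isotopisms -/

section Rigidity

open Finset
open scoped Classical

variable {K F : Type*} [Field K] [Field F] [Algebra K F]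

theorem albertMatrix_comm (κ : Gal(F/K)) (l : Gal(F/K) → F) (g h : Gal(F/K)) :
    albertMatrix κ l g h = albertMatrix κ l h g :=
  add_comm _ _

theorem albertMatrix_self {κ : Gal(F/K)} (hκ : κ ^ 2 ≠ 1) (l : Gal(F/K) → F) (g : Gal(F/K)) :
    albertMatrix κ l g g = 0 := by
  have : κ ≠ 1 := by rintro rfl; simp at hκ
  simp [albertMatrix, this]

theorem albertMatrix_edge {κ : Gal(F/K)} (hκ : κ ^ 2 ≠ 1) (l : Gal(F/K) → F) (g : Gal(F/K)) :
    albertMatrix κ l (g * κ) g = l g := by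
  have : κ * κ ≠ 1 := by rwa [← pow_two]
  simp [albertMatrix, mul_assoc, this]

theorem twistCoeff_mul (σ : Gal(F/K)) (α : F) (l : Gal(F/K) → F) (g : Gal(F/K)) :
    twistCoeff σ α l (g * σ) = l g * g α := by
  simp [twistCoeff]

/-- If the coefficient matrix has rank at most two, then `l` vanishes. An edge `{g, g * κ}` of
nonzero weight gives an invertible `2 × 2` block, which determines the second diagonal block; that
block has nonzero entries at the edge `{g * σ, g * σ * κ}` but can only be nonzero at the edge
`{g, g * κ}`, so `σ = 1` or `κ ^ 2 = 1`. -/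
theorem coeff_eq_zero_of_rank_two {κ σ : Gal(F/K)} (hκ : κ ^ 2 ≠ 1) (hσ : σ ≠ 1) {α : F}
    (hα : α ≠ 0) {l d : Gal(F/K) → F} {p q r s : Gal(F/K) ⊕ Gal(F/K) → F}
    (hB : ∀ i j, productMatrix κ σ α l d i j = p i * q j + r i * s j) : l = 0 := by
  by_contra hl
  obtain ⟨g, hg⟩ := Function.ne_iff.1 hl
  have h := mul_eq_of_rank_two hB (u := Sum.inl (g * κ)) (v := Sum.inl g) hg
    (albertMatrix_self hκ l _) (albertMatrix_self hκ l _) (albertMatrix_edge hκ l g)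
    ((albertMatrix_comm κ l _ _).trans (albertMatrix_edge hκ l g))
    (Sum.inr (g * σ * κ)) (Sum.inr (g * σ))
  simp only [productMatrix, albertMatrix_edge hκ, twistCoeff_mul] at h
  have hne : l g * (l g * g α) ≠ 0 := mul_ne_zero hg (mul_ne_zero hg (by simpa using hα))
  rw [h] at hne
  have hσ' : g ≠ g * σ := by simpa [eq_comm] using hσ
  have hcross : ¬ (g * σ * κ = g ∧ g * κ = g * σ) := by
    rintro ⟨h₁, h₂⟩
    rw [← h₂, mul_assoc, ← pow_two] at h₁
    exact hκ (by simpa using h₁)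
  rw [if_neg hσ'] at hne
  by_cases h₁ : g * σ * κ = g
  · have h₂ : g * κ ≠ g * σ := fun h₂ => hcross ⟨h₁, h₂⟩
    simp [h₂] at hne
  · simp [h₁] at hne

theorem productMatrix_zero_inl_inl (κ σ : Gal(F/K)) (α : F) (d : Gal(F/K) → F) (g h : Gal(F/K)) :
    productMatrix κ σ α 0 d (Sum.inl g) (Sum.inl h) = 0 := by
  simp [productMatrix, albertMatrix]

theorem productMatrix_zero_inr_inr (κ σ : Gal(F/K)) (α : F) (d : Gal(F/K) → F) (g h : Gal(F/K)) :
    productMatrix κ σ α 0 d (Sum.inr g) (Sum.inr h) = 0 := by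
  simp [productMatrix, albertMatrix, twistCoeff]

/-- With `l = 0`, the matrix consists of two diagonal blocks with entries `d`, so rank at most two
leaves room for one nonzero entry of `d`. -/
theorem eq_of_rank_two_of_coeff_ne_zero {κ σ : Gal(F/K)} {α : F} {d : Gal(F/K) → F}
    {p q r s : Gal(F/K) ⊕ Gal(F/K) → F}
    (hB : ∀ i j, productMatrix κ σ α 0 d i j = p i * q j + r i * s j)
    {g h : Gal(F/K)} (hg : d g ≠ 0) (hh : d h ≠ 0) : h = g := by
  by_contra hne
  have hmin := minor_eq_zero_of_rank_two hB (Sum.inl g) (Sum.inl h) (Sum.inr g)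
    (Sum.inr g) (Sum.inr h) (Sum.inl g)
  rw [productMatrix_zero_inl_inl, productMatrix_zero_inl_inl] at hmin
  simp [productMatrix, Ne.symm hne, hg, hh] at hmin

/-- With `l = 0` and `d` supported at `g`, the two vectors `p`, `r` are supported at the two
copies of `g`. -/
theorem support_of_rank_two {κ σ : Gal(F/K)} {α : F} {d : Gal(F/K) → F} {g : Gal(F/K)}
    (hd : ∀ h, h ≠ g → d h = 0) {p q r s : Gal(F/K) ⊕ Gal(F/K) → F}
    (hB : ∀ i j, productMatrix κ σ α 0 d i j = p i * q j + r i * s j)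
    {j₁ j₂ : Gal(F/K) ⊕ Gal(F/K)} (hj : q j₁ * s j₂ - q j₂ * s j₁ ≠ 0)
    {i : Gal(F/K) ⊕ Gal(F/K)} (h₁ : i ≠ Sum.inl g) (h₂ : i ≠ Sum.inr g) : p i = 0 ∧ r i = 0 := by
  refine eq_zero_of_row_eq_zero hB hj fun j => ?_
  rcases i with i | i <;> rcases j with j | j
  · exact productMatrix_zero_inl_inl ..
  · simp [productMatrix, hd i (by simpa using h₁)]
  · simp [productMatrix, hd i (by simpa using h₂)]
  · exact productMatrix_zero_inr_inr ..

theorem productMatrix_comm (κ σ : Gal(F/K)) (α : F) (l d : Gal(F/K) → F)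
    (i j : Gal(F/K) ⊕ Gal(F/K)) :
    productMatrix κ σ α l d i j = productMatrix κ σ α l d j i := by
  rcases i with i | i <;> rcases j with j | j
  · exact albertMatrix_comm ..
  · by_cases h : i = j
    · simp [productMatrix, h]
    · simp [productMatrix, h, Ne.symm h]
  · by_cases h : i = j
    · simp [productMatrix, h]
    · simp [productMatrix, h, Ne.symm h]
  · exact albertMatrix_comm ..

variable [FiniteDimensional K F]

/-- The coefficient vectors of the components of a surjective map to `F × F` are not
proportional. -/
theorem exists_minor_ne_zero {T : F × F → F × F} (hT : Function.Surjective T)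
    {q s : Gal(F/K) ⊕ Gal(F/K) → F} (hq : ∀ x, (T x).1 = ∑ i, q i * evalAut i x)
    (hs : ∀ x, (T x).2 = ∑ i, s i * evalAut i x) :
    ∃ j₁ j₂, q j₁ * s j₂ - q j₂ * s j₁ ≠ 0 := by
  by_contra! h
  have key (j : Gal(F/K) ⊕ Gal(F/K)) (x : F × F) : q j * (T x).2 = s j * (T x).1 := by
    rw [hq, hs, mul_sum, mul_sum]
    refine sum_congr rfl fun i _ => ?_
    linear_combination evalAut i x * h j i
  obtain ⟨x, hx⟩ := hT (0, 1)
  have hq0 (j : Gal(F/K) ⊕ Gal(F/K)) : q j = 0 := by simpa [hx] using key j x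
  obtain ⟨y, hy⟩ := hT (1, 0)
  simpa [hq0, hy] using hq y

theorem sum_eq_of_support {c : Gal(F/K) ⊕ Gal(F/K) → F} {g : Gal(F/K)}
    (hc : ∀ i, i ≠ Sum.inl g → i ≠ Sum.inr g → c i = 0) (x : F × F) :
    ∑ i, c i * evalAut i x = c (Sum.inl g) * g x.1 + c (Sum.inr g) * g x.2 := by
  rw [sum_evalAut]
  congr 1
  · refine Fintype.sum_eq_single g fun h hh => ?_
    rw [hc _ (by simpa using hh) (by simp), zero_mul]
  · refine Fintype.sum_eq_single g fun h hh => ?_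
    rw [hc _ (by simp) (by simpa using hh), zero_mul]

theorem sum_single_mul_aut (w : F) (u v : Gal(F/K)) (a c : F) :
    ∑ g : Gal(F/K), ∑ h : Gal(F/K), (if g = u ∧ h = v then w else 0) * g a * h c =
      w * u a * v c := by
  rw [Fintype.sum_eq_single u, Fintype.sum_eq_single v]
  · simp
  · intro h hh
    simp [hh]
  · intro h hh
    simp [hh]

/-- If a bilinear form with coefficient matrix `albertMatrix κ l` is an `F`-combination of the four
products of automorphisms occurring in a multiplication `autMul ς τ β` of multiples of `g a` and
`g c`, then only these four products have nonzero coefficients. -/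
theorem edge_cases_of_coeff_ne_zero {κ ς τ g : Gal(F/K)} (hκ : κ ^ 2 ≠ 1) {l : Gal(F/K) → F}
    {w₁ w₂ w₃ w₄ : F}
    (h : ∀ a c, ∑ h, l h * h (κ a * c + κ c * a) =
      w₁ * (ς * g) a * g c + w₂ * g a * (ς * g) c +
        w₃ * (τ * ς * g) a * (τ * g) c + w₄ * (τ * g) a * (τ * ς * g) c)
    {f : Gal(F/K)} (hf : l f ≠ 0) :
    (f * κ = ς * g ∧ f = g) ∨ (f * κ = g ∧ f = ς * g) ∨
      (f * κ = τ * ς * g ∧ f = τ * g) ∨ (f * κ = τ * g ∧ f = τ * ς * g) := by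
  have hC := matrix_ext_of_sum (e := fun (g : Gal(F/K)) (x : F) => g x)
    (C := albertMatrix κ l) (D := fun u v => (if u = ς * g ∧ v = g then w₁ else 0) +
      (if u = g ∧ v = ς * g then w₂ else 0) + (if u = τ * ς * g ∧ v = τ * g then w₃ else 0) +
      (if u = τ * g ∧ v = τ * ς * g then w₄ else 0))
    (fun _ => eq_zero_of_sum_aut_eq_zero) fun a c => by
      rw [sum_albertMatrix, h]
      simp only [add_mul, sum_add_distrib]
      simp only [sum_single_mul_aut]
  have hfe := congrFun (congrFun hC (f * κ)) f
  rw [albertMatrix_edge hκ] at hfe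
  rw [hfe] at hf
  by_contra! hcon
  obtain ⟨h₁, h₂, h₃, h₄⟩ := hcon
  apply hf
  rw [if_neg (not_and.2 h₁), if_neg (not_and.2 h₂), if_neg (not_and.2 h₃), if_neg (not_and.2 h₄)]
  simp

/-- Comparing the edges that occur in both diagonal blocks of the first component. -/
theorem eq_or_eq_inv_of_edge_cases {G : Type*} [Group G] (hcomm : ∀ a b : G, a * b = b * a)
    {κ σ ς τ g f : G} (hκ : κ ^ 2 ≠ 1) (hσ : σ ≠ 1)
    (h₁ : (f * κ = ς * g ∧ f = g) ∨ (f * κ = g ∧ f = ς * g) ∨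
      (f * κ = τ * ς * g ∧ f = τ * g) ∨ (f * κ = τ * g ∧ f = τ * ς * g))
    (h₂ : (f * σ * κ = ς * g ∧ f * σ = g) ∨ (f * σ * κ = g ∧ f * σ = ς * g) ∨
      (f * σ * κ = τ * ς * g ∧ f * σ = τ * g) ∨ (f * σ * κ = τ * g ∧ f * σ = τ * ς * g)) :
    (κ = ς ∨ κ = ς⁻¹) ∧ (σ = τ ∨ σ = τ⁻¹) := by
  have key (u : G) (h : (u * κ = ς * g ∧ u = g) ∨ (u * κ = g ∧ u = ς * g) ∨
      (u * κ = τ * ς * g ∧ u = τ * g) ∨ (u * κ = τ * g ∧ u = τ * ς * g)) :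
      (κ = ς ∧ (u = g ∨ u = τ * g)) ∨ (κ = ς⁻¹ ∧ (u = ς * g ∨ u = τ * (ς * g))) := by
    rcases h with ⟨h, rfl⟩ | ⟨h, rfl⟩ | ⟨h, rfl⟩ | ⟨h, rfl⟩
    · exact Or.inl ⟨mul_left_cancel (h.trans (hcomm _ _)), Or.inl rfl⟩
    · refine Or.inr ⟨eq_inv_of_mul_eq_one_right ?_, Or.inl rfl⟩
      rw [hcomm ς g, mul_assoc] at h
      exact mul_eq_left.1 h
    · rw [mul_assoc, mul_assoc] at h
      exact Or.inl ⟨mul_left_cancel ((mul_left_cancel h).trans (hcomm _ _)), Or.inr rfl⟩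
    · refine Or.inr ⟨eq_inv_of_mul_eq_one_right ?_, Or.inr (mul_assoc _ _ _)⟩
      rw [mul_assoc, mul_assoc, hcomm ς, mul_assoc, hcomm κ] at h
      exact mul_eq_left.1 (mul_left_cancel h)
  have hns : ¬ (κ = ς ∧ κ = ς⁻¹) := by
    rintro ⟨rfl, h⟩
    exact hκ (by rw [pow_two]; nth_rewrite 1 [h]; exact inv_mul_cancel _)
  -- Both `f` and `f * σ` lie in `{b, τ * b}` for the same `b`, and they are different.
  have aux (b : G) (hf : f = b ∨ f = τ * b) (hfσ : f * σ = b ∨ f * σ = τ * b) :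
      σ = τ ∨ σ = τ⁻¹ := by
    rcases hf with rfl | rfl <;> rcases hfσ with h | h
    · exact absurd (mul_eq_left.1 h) hσ
    · exact Or.inl (mul_left_cancel (h.trans (hcomm _ _)))
    · refine Or.inr (eq_inv_of_mul_eq_one_right ?_)
      rw [hcomm τ b, mul_assoc] at h
      exact mul_eq_left.1 h
    · exact absurd (mul_eq_left.1 h) hσ
  rcases key _ h₁ with ⟨hk, hf⟩ | ⟨hk, hf⟩ <;> rcases key _ h₂ with ⟨hk', hf'⟩ | ⟨hk', hf'⟩
  · exact ⟨Or.inl hk, aux _ hf hf'⟩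
  · exact absurd ⟨hk, hk'⟩ hns
  · exact absurd ⟨hk', hk⟩ hns
  · exact ⟨Or.inr hk, aux _ hf hf'⟩

/-- Isotopic multiplications have, up to inversion, the same pair of automorphisms. -/
theorem eq_or_eq_inv_of_isotopism [IsGalois K F] (hcomm : ∀ g h : Gal(F/K), g * h = h * g)
    {κ σ ς τ : Gal(F/K)} (hκ : κ ^ 2 ≠ 1) (hσ : σ ≠ 1) {α β : F} (hα : α ≠ 0)
    (M N L : (F × F) ≃ₗ[K] (F × F))
    (hMNL : ∀ x y, autMul ς τ β (M x) (N y) = L (autMul κ σ α x y)) :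
    (κ = ς ∨ κ = ς⁻¹) ∧ (σ = τ ∨ σ = τ⁻¹) := by
  obtain ⟨m₁, hm₁⟩ := exists_eq_sum_evalAut (LinearMap.fst K F F ∘ₗ M.toLinearMap)
  obtain ⟨m₂, hm₂⟩ := exists_eq_sum_evalAut (LinearMap.snd K F F ∘ₗ M.toLinearMap)
  obtain ⟨n₁, hn₁⟩ := exists_eq_sum_evalAut (LinearMap.fst K F F ∘ₗ N.toLinearMap)
  obtain ⟨n₂, hn₂⟩ := exists_eq_sum_evalAut (LinearMap.snd K F F ∘ₗ N.toLinearMap)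
  obtain ⟨e, he⟩ := exists_eq_sum_evalAut (LinearMap.fst K F F ∘ₗ L.toLinearMap)
  obtain ⟨c, hc⟩ := exists_eq_sum_evalAut (LinearMap.snd K F F ∘ₗ L.toLinearMap)
  simp only [LinearMap.comp_apply, LinearMap.fst_apply, LinearMap.snd_apply,
    LinearEquiv.coe_coe] at hm₁ hm₂ hn₁ hn₂ he hc
  -- The second component of the isotopism equation equates a matrix of rank two with `B`.
  have hB (i j) : productMatrix κ σ α (fun g => c (Sum.inl g)) (fun g => c (Sum.inr g)) i j =
      m₁ i * n₂ j + m₂ i * n₁ j := by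
    refine congrFun (congrFun (matrix_ext_of_sum (e := evalAut)
      (D := fun i j => m₁ i * n₂ j + m₂ i * n₁ j)
      (fun _ => eq_zero_of_sum_evalAut_eq_zero) fun x y => ?_) i) j
    rw [sum_productMatrix, ← hc, ← hMNL]
    simp only [autMul, hm₁, hm₂, hn₁, hn₂, sum_mul_sum, ← sum_add_distrib]
    refine sum_congr rfl fun i _ => sum_congr rfl fun j _ => ?_
    ring
  have hl : (fun g => c (Sum.inl g)) = 0 := coeff_eq_zero_of_rank_two hκ hσ hα hB
  rw [hl] at hB
  obtain ⟨g, hg⟩ : ∃ g, c (Sum.inr g) ≠ 0 := by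
    by_contra! h0
    obtain ⟨x, hx⟩ := L.surjective (0, 1)
    have := hc x
    rw [sum_evalAut] at this
    simp [hx, h0, fun g => congrFun hl g] at this
  have hd (h) (hh : h ≠ g) : c (Sum.inr h) = 0 := by
    by_contra h0
    exact hh (eq_of_rank_two_of_coeff_ne_zero hB hg h0)
  -- `B` is symmetric, so the same argument bounds the supports of the coefficients of `N`.
  have hB' (i j) : productMatrix κ σ α 0 (fun g => c (Sum.inr g)) i j =
      n₂ i * m₁ j + n₁ i * m₂ j := by
    rw [productMatrix_comm, hB]; ring
  obtain ⟨j₁, j₂, hj⟩ := exists_minor_ne_zero N.surjective hn₁ hn₂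
  have hj' : n₂ j₁ * n₁ j₂ - n₂ j₂ * n₁ j₁ ≠ 0 := fun h => hj (by linear_combination -h)
  obtain ⟨k₁, k₂, hk⟩ := exists_minor_ne_zero M.surjective hm₁ hm₂
  have hM (x) := sum_eq_of_support (fun i h₁ h₂ => (support_of_rank_two hd hB hj' h₁ h₂).1) x
  have hM₂ (x) := sum_eq_of_support (fun i h₁ h₂ => (support_of_rank_two hd hB hj' h₁ h₂).2) x
  have hN (x) := sum_eq_of_support (fun i h₁ h₂ => (support_of_rank_two hd hB' hk h₁ h₂).2) x
  have hN₂ (x) := sum_eq_of_support (fun i h₁ h₂ => (support_of_rank_two hd hB' hk h₁ h₂).1) x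
  simp only [← hm₁, ← hm₂, ← hn₁, ← hn₂] at hM hM₂ hN hN₂
  -- `L` is injective and its second component kills `F × 0`, so its first component does not.
  obtain ⟨f, hf⟩ : ∃ f, e (Sum.inl f) ≠ 0 := by
    by_contra! h0
    have h1 : L (1, 0) = 0 := by
      ext
      · rw [he, sum_evalAut]; simp [h0]
      · rw [hc, sum_evalAut]; simp [fun g => congrFun hl g]
    simp at h1
  have hfσ : twistCoeff σ α (fun g => e (Sum.inl g)) (f * σ) ≠ 0 := by
    rw [twistCoeff_mul]
    exact mul_ne_zero hf (by simpa using hα)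
  refine eq_or_eq_inv_of_edge_cases hcomm (g := g) (f := f) hκ hσ
    (edge_cases_of_coeff_ne_zero hκ (l := fun g => e (Sum.inl g))
      (w₁ := ς (m₁ (Sum.inl g)) * n₁ (Sum.inl g)) (w₂ := m₁ (Sum.inl g) * ς (n₁ (Sum.inl g)))
      (w₃ := β * τ (ς (m₂ (Sum.inl g)) * n₂ (Sum.inl g)))
      (w₄ := β * τ (m₂ (Sum.inl g) * ς (n₂ (Sum.inl g)))) (fun a b => ?_) hf)
    (edge_cases_of_coeff_ne_zero hκ (l := twistCoeff σ α fun g => e (Sum.inl g))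
      (w₁ := ς (m₁ (Sum.inr g)) * n₁ (Sum.inr g)) (w₂ := m₁ (Sum.inr g) * ς (n₁ (Sum.inr g)))
      (w₃ := β * τ (ς (m₂ (Sum.inr g)) * n₂ (Sum.inr g)))
      (w₄ := β * τ (m₂ (Sum.inr g) * ς (n₂ (Sum.inr g)))) (fun a b => ?_) hfσ)
  · have h₁ := congrArg Prod.fst (hMNL (a, 0) (b, 0))
    rw [he, sum_evalAut] at h₁
    simp only [autMul, hM, hM₂, hN, hN₂, map_zero, mul_zero, add_zero, zero_mul, sum_const_zero] at h₁
    rw [← h₁]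
    simp only [map_add, map_mul, AlgEquiv.mul_apply]
    ring
  · have h₁ := congrArg Prod.fst (hMNL (0, a) (0, b))
    rw [he, sum_evalAut] at h₁
    simp only [autMul, hM, hM₂, hN, hN₂, map_zero, mul_zero, add_zero, zero_add, zero_mul,
      sum_const_zero] at h₁
    rw [sum_twistCoeff, ← h₁]
    simp only [map_add, map_mul, AlgEquiv.mul_apply]
    ring

end Rigidity

/-! ### Powers of Frobenius -/

section GaloisField

open FiniteField

variable (p : ℕ) [Fact p.Prime] (m : ℕ)

theorem frobenius_pow_apply (k : ℕ) (x : GaloisField p m) :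
    (frobeniusAlgEquivOfAlgebraic (ZMod p) (GaloisField p m) ^ k) x = x ^ (p ^ k) := by
  rw [AlgEquiv.coe_pow, coe_frobeniusAlgEquivOfAlgebraic_iterate, ZMod.card]

variable {m}

theorem frobenius_pow_eq_iff (hm : m ≠ 0) {a b : ℕ} :
    frobeniusAlgEquivOfAlgebraic (ZMod p) (GaloisField p m) ^ a =
      frobeniusAlgEquivOfAlgebraic (ZMod p) (GaloisField p m) ^ b ↔ a ≡ b [MOD m] := by
  rw [pow_eq_pow_iff_modEq, orderOf_frobeniusAlgEquivOfAlgebraic, GaloisField.finrank p hm]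

/-- Exponents in `[0, m / 2]` represent the classes of powers of Frobenius up to inversion. -/
theorem eq_of_frobenius_pow_eq_or_eq_inv (hm : m ≠ 0) {a b : ℕ} (ha : a ≤ m / 2) (hb : b ≤ m / 2)
    (h : frobeniusAlgEquivOfAlgebraic (ZMod p) (GaloisField p m) ^ a =
        frobeniusAlgEquivOfAlgebraic (ZMod p) (GaloisField p m) ^ b ∨
      frobeniusAlgEquivOfAlgebraic (ZMod p) (GaloisField p m) ^ a =
        (frobeniusAlgEquivOfAlgebraic (ZMod p) (GaloisField p m) ^ b)⁻¹) : a = b := by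
  rcases h with h | h
  · exact ((frobenius_pow_eq_iff p hm).1 h).eq_of_lt_of_lt (by omega) (by omega)
  · rw [eq_inv_iff_mul_eq_one, ← pow_add, ← pow_zero (frobeniusAlgEquivOfAlgebraic _ _),
      frobenius_pow_eq_iff p hm, Nat.modEq_zero_iff_dvd] at h
    obtain ⟨c, hc⟩ := h
    rcases c with _ | _ | c
    · omega
    · omega
    · have : m * 2 ≤ m * (c + 2) := Nat.mul_le_mul_left m (by omega)
      have : m * (c + 1 + 1) = m * (c + 2) := rfl
      omega

end GaloisField

theorem mainTheorem5 (p : ℕ) [Fact p.Prime] (hp : Odd p) (m k s r t : ℕ)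
    (hk : 0 < k) (hkm : k ≤ m / 2) (hs : 0 < s) (hsm : s ≤ m / 2)
    (hr : r ≤ m / 2) (ht : t ≤ m / 2)
    (hmk : Odd (m / Nat.gcd m k)) (hms : Odd (m / Nat.gcd m s))
    (α β : GaloisField p m) (hα : ¬ IsSquare α) (hβ : ¬ IsSquare β)
    (σ τ : GaloisField p m ≃+* GaloisField p m)
    (hσ : ∀ x, σ x = x ^ (p ^ r)) (hτ : ∀ x, τ x = x ^ (p ^ t))
    (hσ_nontrivial : σ ≠ RingEquiv.refl (GaloisField p m))
    (hne : (k, σ) ≠ (s, τ)) :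
    ¬ IsIsotopic p (presemifieldMul p k σ α) (presemifieldMul p s τ β) := by
  rintro ⟨M, N, L, hMNL⟩
  have hm : m ≠ 0 := by omega
  have hα0 : α ≠ 0 := by rintro rfl; exact hα (IsSquare.zero)
  set φ := FiniteField.frobeniusAlgEquivOfAlgebraic (ZMod p) (GaloisField p m) with hφ
  have hmul (k r : ℕ) (σ : GaloisField p m ≃+* GaloisField p m) (hσ : ∀ x, σ x = x ^ (p ^ r))
      (α : GaloisField p m) : presemifieldMul p k σ α = autMul (φ ^ k) (φ ^ r) α := by
    funext x y
    simp only [presemifieldMul, albertMul, autMul, hφ, frobenius_pow_apply, hσ]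
  rw [hmul k r σ hσ, hmul s t τ hτ] at hMNL
  have hκ : (φ ^ k) ^ 2 ≠ 1 := by
    intro h
    rw [← pow_mul, ← pow_zero φ, frobenius_pow_eq_iff p hm, Nat.modEq_zero_iff_dvd] at h
    have hmk2 : m = k * 2 := Nat.le_antisymm (Nat.le_of_dvd (by omega) h) (by omega)
    -- `m = 2 * k` is excluded because then `m / gcd m k = 2`.
    rw [Nat.gcd_eq_right ⟨2, hmk2⟩, hmk2, Nat.mul_div_cancel_left _ hk] at hmk
    exact absurd hmk (by decide)
  have hσ1 : φ ^ r ≠ 1 := by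
    intro h
    apply hσ_nontrivial
    ext x
    rw [hσ, ← frobenius_pow_apply, ← hφ, h]
    rfl
  have hcomm (g h : Gal(GaloisField p m/ZMod p)) : g * h = h * g := mul_comm' g h
  obtain ⟨h₁, h₂⟩ := eq_or_eq_inv_of_isotopism hcomm hκ hσ1 hα0 M N L hMNL
  have hks : k = s := eq_of_frobenius_pow_eq_or_eq_inv p hm hkm hsm h₁
  have hrt : r = t := eq_of_frobenius_pow_eq_or_eq_inv p hm hr ht h₂
  subst hks hrt
  exact hne (Prod.ext rfl (RingEquiv.ext fun x => (hσ x).trans (hτ x).symm))
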